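/- Fix $k,d\ge 1$ and an arbitrary norm $\|\cdot\|$ on $\mathbb R^d$. Operations, inequalities and limits of vectors are taken coordinatewise; $\mathbf n\to\boldsymbol\infty$, for $\mathbf n\in\mathbb N^k$, means that all coordinates of $\mathbf n$ tend to infinity. Let $X=(X(\mathbf t):\mathbf t\in\mathbb Z^k)$ be a (strictly) stationary $\mathbb R^d$-valued random field that is jointly regularly varying with index $\alpha>0$: for all $m\ge1$ and $\mathbf t_1,\dots,\mathbf t_m\in\mathbb Z^k$, with $Z=(X(\mathbf t_1),\dots,X(\mathbf t_m))\in\mathbb R^{md}$, there are a function $V:(0,\infty)\to(0,\infty)$ with $V(cx)/V(x)\to c^{-\alpha}$ as $x\to\infty$ for all $c>0$, and a nonzero Radon measure $\mu$ on $[-\infty,\infty]^{md}\setminus\{\mathbf 0\}$ that does not charge infinite points, such that $\mathbb P(x^{-1}Z\in\cdot)/V(x)\to\mu$ vaguely as $x\to\infty$. Let $Y=(Y(\mathbf t):\mathbf t\in\mathbb Z^k)$ be its tail field, i.e. the limit, as $x\to\infty$, of the finite-dimensional distributions of $(x^{-1}X(\mathbf t):\mathbf t\in\mathbb Z^k)$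 given $\|X(\mathbf 0)\|>x$. Let $\mathbf i\in\{0,1\}^k$ and let $$\theta_{\mathrm{tf},\mathbf i}=\mathbb P\Big(\sup_{\mathbf t\ne\mathbf 0,\ \mathbf t(\mathbf 1-2\mathbf i)\ge\mathbf 0}\|Y(\mathbf t)\|\le 1\Big)$$ be the tail field extremal index. A *level array* is an array $(u_{\mathbf n})_{\mathbf n\in\mathbb N^k}$ of real numbers with $\big(\prod_{\ell}n_\ell\big)\,\mathbb P(\|X(\mathbf 0)\|>u_{\mathbf n})\to\tau$ as $\mathbf n\to\boldsymbol\infty$, for some $\tau>0$. A *block array* is an array $(\mathbf r_{\mathbf n})_{\mathbf n\in\mathbb N^k}$ in $\mathbb N_0^k$, nondecreasing in $\mathbf n$, with $\mathbf r_{\mathbf n}\to\boldsymbol\infty$ and $\mathbf r_{\mathbf n}/\mathbf n\to\mathbf 0$. Put $\mathcal R_{\mathbf n}=\{\mathbf t\in\mathbb Z^k:\mathbf 0\le\mathbf t\le\mathbf r_{\mathbf n}-\mathbf 1\}$, let $\mathbf t_{\mathbf n}$ be the corner of $\mathcal R_{\mathbf n}$ with $\ell$-th coordinate $(\mathbf r_{\mathbf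 n})_\ell-1$ if $i_\ell=1$ and $0$ if $i_\ell=0$, let $A_{\mathbf n,M}=\{\mathbf x\in\mathcal R_{\mathbf n}:|x_\ell-(\mathbf t_{\mathbf n})_\ell|\le M,\ \ell=1,\dots,k\}$, and write $M_X(A)=\max_{\mathbf t\in A}\|X(\mathbf t)\|$. The *run extremal index* $\theta_{\mathrm{run},\mathbf i}$ exists and equals $\theta$ if there is a block array $(\mathbf r_{\mathbf n})$ such that for every level array $(u_{\mathbf n})$ $$\lim_{\mathbf n\to\boldsymbol\infty}\mathbb P\big(M_X(\mathcal R_{\mathbf n}\setminus\{\mathbf t_{\mathbf n}\})\le u_{\mathbf n}\,\big|\,\|X(\mathbf t_{\mathbf n})\|>u_{\mathbf n}\big)=\theta.\qquad(1)$$ The *anti-clustering condition* holds for $(\mathbf r_{\mathbf n})$ and $(u_{\mathbf n})$ if $$\lim_{M\to\infty}\limsup_{\mathbf n\to\boldsymbol\infty}\mathbb P\big(M_X(A_{\mathbf n,M}\setminus\{\mathbf t_{\mathbf n}\})\le u_{\mathbf n},\ M_X(\mathcal R_{\mathbf n}\setminus A_{\mathbf n,M})>u_{\mathbf n}\,\big|\,\|X(\mathbf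 t_{\mathbf n})\|>u_{\mathbf n}\big)=0.\qquad(2)$$ **Proposition.** (a) If for every level array $(u_{\mathbf n})$ there is a block array $(\mathbf r_{\mathbf n})$ such that (2) holds, then the run extremal index $\theta_{\mathrm{run},\mathbf i}$ exists and equals $\theta_{\mathrm{tf},\mathbf i}$. (b) Moreover, for each block array $(\mathbf r_{\mathbf n})$ and each level array $(u_{\mathbf n})$ for which (2) holds, (1) holds with $\theta=\theta_{\mathrm{tf},\mathbf i}$ along these same arrays. In particular, if a single block array $(\mathbf r_{\mathbf n})$ satisfies (2) with every level array, then this same $(\mathbf r_{\mathbf n})$ can be taken in the definition of $\theta_{\mathrm{run},\mathbf i}=\theta_{\mathrm{tf},\mathbf i}$. -/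

import Mathlib

open MeasureTheory ProbabilityTheory Filter Topology

noncomputable section

namespace RandomField

/-! ## Regular variation -/

/-- `V : (0, ∞) → (0, ∞)` is regularly varying with (tail) exponent `α`:
`V (c x) / V x → c ^ (-α)` as `x → ∞`, for every `c > 0`. -/
def IsRegularlyVaryingFun (V : ℝ → ℝ) (α : ℝ) : Prop :=
  Measurable V ∧ (∀ x : ℝ, 0 < x → 0 < V x) ∧
    ∀ c : ℝ, 0 < c → Tendsto (fun x : ℝ => V (c * x) / V x) atTop (𝓝 (c ^ (-α)))

/-- A measure on `[-∞, ∞]^ι` that represents a nonzero Radon measure on the punctured space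
`[-∞, ∞]^ι \ {0}` which does not charge infinite points. (The compact subsets of the punctured
space are the closed subsets of the complements of the open neighbourhoods of the origin.) -/
structure IsTailMeasure {ι : Type*} [Fintype ι] (m : Measure (ι → EReal)) : Prop where
  ne_zero : m ≠ 0
  origin : m {0} = 0
  finite_away : ∀ U : Set (ι → EReal), IsOpen U → (0 : ι → EReal) ∈ U → m Uᶜ < ⊤
  infinite_points : m {y | ∃ j, y j = ⊤ ∨ y j = ⊥} = 0

/-- Multivariate regular variation with exponent `α` of a random vector `Z` in `ℝ^ι`:
`P (x⁻¹ Z ∈ ·) / V x` converges vaguely on `[-∞, ∞]^ι \ {0}` to a tail measure. The test functions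
are the continuous functions with compact support in the punctured space, i.e. the continuous
functions on `[-∞, ∞]^ι` that vanish in a neighbourhood of the origin. -/
def IsRegularlyVaryingVector {Ω : Type*} [MeasurableSpace Ω] (P : Measure Ω)
    {ι : Type*} [Fintype ι] (Z : Ω → ι → ℝ) (α : ℝ) : Prop :=
  ∃ (V : ℝ → ℝ) (m : Measure (ι → EReal)), IsRegularlyVaryingFun V α ∧ IsTailMeasure m ∧
    ∀ f : C(ι → EReal, ℝ), (∀ᶠ y in 𝓝 (0 : ι → EReal), f y = 0) →
      Tendsto (fun x : ℝ => (∫ ω, f (fun j => ((x⁻¹ * Z ω j : ℝ) : EReal)) ∂P) / V x) atTop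
        (𝓝 (∫ y, f y ∂m))

/-- The field `X` is jointly regularly varying with index `α`: every vector
`(X (t 1), …, X (t n))`, `n ≥ 1`, is regularly varying in `ℝ^{nd}` with exponent `α`. -/
def IsJointlyRegularlyVarying {Ω : Type*} [MeasurableSpace Ω] (P : Measure Ω) {k d : ℕ}
    (X : (Fin k → ℤ) → Ω → Fin d → ℝ) (α : ℝ) : Prop :=
  ∀ (n : ℕ), 0 < n → ∀ t : Fin n → Fin k → ℤ,
    IsRegularlyVaryingVector P (fun ω (j : Fin n × Fin d) => X (t j.1) ω j.2) α

/-- (Strict) stationarity: the law of the whole field is invariant under all shifts. -/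
def IsStationary {Ω : Type*} [MeasurableSpace Ω] (P : Measure Ω) {k d : ℕ}
    (X : (Fin k → ℤ) → Ω → Fin d → ℝ) : Prop :=
  ∀ h : Fin k → ℤ, P.map (fun ω t => X (t + h) ω) = P.map (fun ω t => X t ω)

/-- `Y` is the tail field of `X` (with respect to the norm `N` on `ℝ^d`): as `x → ∞`, the
finite-dimensional distributions of `x⁻¹ X` given `‖X 0‖ > x` converge weakly to those of `Y`. -/
def IsTailField {Ω Ω' : Type*} [MeasurableSpace Ω] [MeasurableSpace Ω'] (P : Measure Ω)
    (P' : Measure Ω') {k d : ℕ} (N : Seminorm ℝ (Fin d → ℝ))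
    (X : (Fin k → ℤ) → Ω → Fin d → ℝ) (Y : (Fin k → ℤ) → Ω' → Fin d → ℝ) : Prop :=
  ∀ (S : Finset (Fin k → ℤ)) (f : BoundedContinuousFunction (S → Fin d → ℝ) ℝ),
    Tendsto (fun x : ℝ => ∫ ω, f (fun t => x⁻¹ • X t ω) ∂(cond P {ω | x < N (X 0 ω)})) atTop
      (𝓝 (∫ ω, f (fun t => Y t ω) ∂P'))

/-! ## Blocks, corners, arrays -/

/-- `M_X(A)`, the maximum of `‖X t‖` over the finite set `A` (`0` if `A` is empty). -/
def maxNorm {Ω : Type*} {k d : ℕ} (N : Seminorm ℝ (Fin d → ℝ))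
    (X : (Fin k → ℤ) → Ω → Fin d → ℝ) (A : Finset (Fin k → ℤ)) (ω : Ω) : ℝ :=
  ((A.sup fun t => (N (X t ω)).toNNReal : NNReal) : ℝ)

/-- The block `[0 : r - 1]` in `ℤ^k`. -/
def block {k : ℕ} (r : Fin k → ℕ) : Finset (Fin k → ℤ) :=
  Finset.Icc 0 (fun l => (r l : ℤ) - 1)

/-- The corner of the block `[0 : r - 1]` determined by `i ∈ {0,1}^k`. -/
def corner {k : ℕ} (r : Fin k → ℕ) (i : Fin k → Fin 2) : Fin k → ℤ :=
  fun l => if i l = 1 then (r l : ℤ) - 1 else 0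

/-- The points of the block `[0 : r - 1]` whose coordinates are within distance `M` of those of
the corner determined by `i`. -/
def cornerBox {k : ℕ} (r : Fin k → ℕ) (i : Fin k → Fin 2) (M : ℕ) : Finset (Fin k → ℤ) :=
  (block r).filter fun x => ∀ l, |x l - corner r i l| ≤ (M : ℤ)

/-- An array `(r n)`, `n ∈ ℕ^k`, increasing to `∞` and such that `r n / n → 0`
(all coordinatewise, as all coordinates of `n` tend to infinity). -/
structure IsBlockArray {k : ℕ} (r : (Fin k → ℕ) → (Fin k → ℕ)) : Prop where
  mono : Monotone r
  tendsto : Tendsto r atTop atTop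
  small : ∀ l, Tendsto (fun n : Fin k → ℕ => (r n l : ℝ) / (n l : ℝ)) atTop (𝓝 0)

/-- The levels `(u n)` satisfy `(∏ n_l) P (‖X 0‖ > u n) → τ` as `n → ∞`. -/
def IsLevelArray {Ω : Type*} [MeasurableSpace Ω] (P : Measure Ω) {k d : ℕ}
    (N : Seminorm ℝ (Fin d → ℝ)) (X : (Fin k → ℤ) → Ω → Fin d → ℝ) (τ : ℝ)
    (u : (Fin k → ℕ) → ℝ) : Prop :=
  Tendsto (fun n : Fin k → ℕ => (∏ l, (n l : ℝ)) * P.real {ω | u n < N (X 0 ω)}) atTop (𝓝 τ)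

/-! ## Extremal indices -/

/-- Along the arrays `r` and `u`, the conditional probability that there is no exceedance in the
block outside of the corner `i`, given an exceedance at this corner, converges to `θ`. -/
def RunLimit {Ω : Type*} [MeasurableSpace Ω] (P : Measure Ω) {k d : ℕ}
    (N : Seminorm ℝ (Fin d → ℝ)) (X : (Fin k → ℤ) → Ω → Fin d → ℝ) (i : Fin k → Fin 2)
    (r : (Fin k → ℕ) → (Fin k → ℕ)) (u : (Fin k → ℕ) → ℝ) (θ : ℝ) : Prop :=
  Tendsto (fun n : Fin k → ℕ =>
      (cond P {ω | u n < N (X (corner (r n) i) ω)}).real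
        {ω | maxNorm N X (block (r n) \ {corner (r n) i}) ω ≤ u n})
    atTop (𝓝 θ)

/-- The run extremal index of `X` with respect to the corner `i` exists and is equal to `θ`. -/
def HasRunExtremalIndex {Ω : Type*} [MeasurableSpace Ω] (P : Measure Ω) {k d : ℕ}
    (N : Seminorm ℝ (Fin d → ℝ)) (X : (Fin k → ℤ) → Ω → Fin d → ℝ) (i : Fin k → Fin 2)
    (θ : ℝ) : Prop :=
  ∃ r : (Fin k → ℕ) → (Fin k → ℕ), IsBlockArray r ∧
    ∀ τ : ℝ, 0 < τ → ∀ u : (Fin k → ℕ) → ℝ, IsLevelArray P N X τ u → RunLimit P N X i r u θ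

/-- The tail field extremal index with respect to the corner `i`. -/
def tailFieldExtremalIndex {Ω' : Type*} [MeasurableSpace Ω'] (P' : Measure Ω') {k d : ℕ}
    (N : Seminorm ℝ (Fin d → ℝ)) (Y : (Fin k → ℤ) → Ω' → Fin d → ℝ) (i : Fin k → Fin 2) : ℝ :=
  P'.real {ω | (⨆ (t : Fin k → ℤ) (_ : (∀ l, 0 ≤ t l * (1 - 2 * ((i l : ℕ) : ℤ))) ∧ t ≠ 0),
    ENNReal.ofReal (N (Y t ω))) ≤ 1}

/-- The anti-clustering condition at the corner `i`, along the arrays `r` and `u`. -/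
def AntiClustering {Ω : Type*} [MeasurableSpace Ω] (P : Measure Ω) {k d : ℕ}
    (N : Seminorm ℝ (Fin d → ℝ)) (X : (Fin k → ℤ) → Ω → Fin d → ℝ) (i : Fin k → Fin 2)
    (r : (Fin k → ℕ) → (Fin k → ℕ)) (u : (Fin k → ℕ) → ℝ) : Prop :=
  Tendsto (fun M : ℕ => limsup (fun n : Fin k → ℕ =>
      cond P {ω | u n < N (X (corner (r n) i) ω)}
        {ω | maxNorm N X (cornerBox (r n) i M \ {corner (r n) i}) ω ≤ u n ∧
          u n < maxNorm N X (block (r n) \ cornerBox (r n) i M) ω}) atTop)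
    atTop (𝓝 0)

end RandomField

end

noncomputable section

namespace RandomField

/-! ## Norms on `ℝ^d` -/

/-! Shifting the corner to the origin turns the part of the block within distance `M` of it into a
fixed finite box in the orthant of `i`, once the block sides exceed `M`. Given an exceedance at the
origin, the probability of no other exceedance in this box converges to its tail field counterpart,
and as `M` grows these limits decrease to the tail field extremal index (`tendsto_orthantBox`). For
(b), anti-clustering makes the rest of the block negligible (`AntiClustering.runLimit`).

For (a), one block array serving all level arrays is built by diagonalization
(`hasRunExtremalIndex_of_tendsto_cond`). Its sides grow so slowly that every level array eventually
exceeds the thresholds beyond which the probability for the current box is close to its limit.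

Weak convergence gives convergence of these probabilities only if the tail field does not charge the
unit sphere (`IsTailField.measure_sphere_eq_zero`). Without the conditioning, stationarity and
regular variation bound the mass of a thin shell around the sphere by a difference of homogeneous
radial limits, which vanishes as the shell shrinks. -/

theorem seminorm_continuous {d : ℕ} (N : Seminorm ℝ (Fin d → ℝ)) : Continuous N :=
  continuousOn_univ.1 (N.convexOn.continuousOn isOpen_univ)

theorem exists_norm_lower_bound {d : ℕ} (N : Seminorm ℝ (Fin d → ℝ)) (hN : ∀ x, N x = 0 → x = 0) :
    ∃ c : ℝ, 0 < c ∧ ∀ x, c * ‖x‖ ≤ N x := by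
  -- The sphere is empty exactly when `d = 0`, where any constant works; otherwise `N` attains a
  -- positive minimum on it.
  rcases (Metric.sphere (0 : Fin d → ℝ) 1).eq_empty_or_nonempty with he | hne
  · refine ⟨1, one_pos, fun x => ?_⟩
    rcases eq_or_ne x 0 with rfl | hx
    · simp
    · have : ‖x‖⁻¹ • x ∈ Metric.sphere (0 : Fin d → ℝ) 1 := by
        simp [norm_smul, hx]
      rw [he] at this
      exact this.elim
  · obtain ⟨z, hz, hmin⟩ := (isCompact_sphere (0 : Fin d → ℝ) 1).exists_isMinOn hne
      (seminorm_continuous N).continuousOn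
    have hz1 : ‖z‖ = 1 := by simpa using hz
    refine ⟨N z, lt_of_le_of_ne (apply_nonneg N z) ?_, fun x => ?_⟩
    · intro h
      rw [hN z h.symm] at hz1
      simp at hz1
    · rcases eq_or_ne x 0 with rfl | hx
      · simp
      · have hmem : ‖x‖⁻¹ • x ∈ Metric.sphere (0 : Fin d → ℝ) 1 := by
          simp [norm_smul, hx]
        have h := hmin hmem
        simp only [Set.mem_ofPred_eq, map_smul_eq_mul, norm_inv, norm_norm] at h
        have hx' : 0 < ‖x‖ := norm_pos_iff.2 hx
        rwa [← div_eq_inv_mul, le_div_iff₀ hx'] at h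

/-! ## Piecewise linear cut-offs -/

/-- The function which is `0` on `(-∞, a]`, `1` on `[b, ∞)`, and linear in between. -/
def ramp (a b s : ℝ) : ℝ := max 0 (min 1 ((s - a) / (b - a)))

theorem ramp_continuous (a b : ℝ) : Continuous (ramp a b) := by
  unfold ramp; fun_prop

theorem ramp_nonneg (a b s : ℝ) : 0 ≤ ramp a b s := le_max_left _ _

theorem ramp_le_one (a b s : ℝ) : ramp a b s ≤ 1 := max_le zero_le_one (min_le_left _ _)

theorem ramp_eq_zero {a b s : ℝ} (hab : a < b) (h : s ≤ a) : ramp a b s = 0 := by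
  have : (s - a) / (b - a) ≤ 0 := div_nonpos_of_nonpos_of_nonneg (by linarith) (by linarith)
  exact max_eq_left ((min_le_right _ _).trans this)

theorem ramp_eq_one {a b s : ℝ} (hab : a < b) (h : b ≤ s) : ramp a b s = 1 := by
  have : 1 ≤ (s - a) / (b - a) := by rw [le_div_iff₀] <;> linarith
  rw [ramp, min_eq_left this, max_eq_right zero_le_one]

theorem ramp_pos {a b s : ℝ} (hab : a < b) (h : a < s) : 0 < ramp a b s :=
  lt_max_of_lt_right (lt_min one_pos (div_pos (by linarith) (by linarith)))

theorem ramp_smul {c : ℝ} (hc : 0 < c) (a b s : ℝ) : ramp (c * a) (c * b) (c * s) = ramp a b s := by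
  rw [ramp, ramp, ← mul_sub, ← mul_sub, mul_div_mul_left _ _ hc.ne']

theorem ramp_anti {a b a' b' : ℝ} (hab : a < b) (h : b ≤ a') (hab' : a' < b') (s : ℝ) :
    ramp a' b' s ≤ ramp a b s := by
  rcases le_total s a' with hs | hs
  · rw [ramp_eq_zero hab' hs]; exact ramp_nonneg _ _ _
  · rw [ramp_eq_one hab (h.trans hs)]; exact ramp_le_one _ _ _

/-! ## Test functions on the compactified space -/

/-- Truncation of an extended real number to the interval `[-R, R]`. -/
def clamp (R : ℝ) (y : EReal) : ℝ := (max ((-R : ℝ) : EReal) (min (R : EReal) y)).toReal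

theorem clamp_continuous (R : ℝ) : Continuous (clamp R) := by
  refine EReal.continuousOn_toReal.comp_continuous (by fun_prop) fun y => ?_
  simp only [Set.mem_compl_iff, Set.mem_insert_iff, Set.mem_singleton_iff, not_or]
  refine ⟨(lt_max_of_lt_left (EReal.bot_lt_coe _)).ne', (max_lt (EReal.coe_lt_top _) ?_).ne⟩
  exact min_lt_of_left_lt (EReal.coe_lt_top _)

theorem ereal_coe_min (a b : ℝ) : ((min a b : ℝ) : EReal) = min (a : EReal) b :=
  EReal.coe_strictMono.monotone.map_min

theorem ereal_coe_max (a b : ℝ) : ((max a b : ℝ) : EReal) = max (a : EReal) b :=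
  EReal.coe_strictMono.monotone.map_max

theorem clamp_coe (R z : ℝ) : clamp R (z : EReal) = max (-R) (min R z) := by
  rw [clamp, ← ereal_coe_min, ← ereal_coe_max, EReal.toReal_coe]

theorem abs_clamp_top {R : ℝ} (hR : 0 ≤ R) : |clamp R ⊤| = R := by
  rw [clamp, min_eq_left le_top, ← ereal_coe_max, EReal.toReal_coe, max_eq_right (by linarith),
    abs_of_nonneg hR]

theorem abs_clamp_bot {R : ℝ} (hR : 0 ≤ R) : |clamp R ⊥| = R := by
  rw [clamp, min_eq_right bot_le, max_eq_left bot_le, EReal.toReal_coe, abs_neg, abs_of_nonneg hR]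

theorem abs_clamp_coe {R : ℝ} (hR : 0 ≤ R) (z : ℝ) : |clamp R z| = min R |z| := by
  rw [clamp_coe]
  rcases le_total 0 z with hz | hz
  · rw [abs_of_nonneg hz, max_eq_right, abs_of_nonneg] <;>
    have := le_min hR hz <;> linarith
  · rw [min_eq_right (hz.trans hR), abs_of_nonpos hz, abs_of_nonpos (max_le (by linarith) hz),
      ← min_neg_neg, neg_neg]

/-- Coordinatewise truncation. -/
def clampVec {ι : Type*} {d : ℕ} (R : ℝ) (e : Fin d → ι) (y : ι → EReal) : Fin d → ℝ :=
  fun l => clamp R (y (e l))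

theorem clampVec_continuous {ι : Type*} {d : ℕ} (R : ℝ) (e : Fin d → ι) :
    Continuous (clampVec R e) :=
  continuous_pi fun l => (clamp_continuous R).comp (continuous_apply (e l))

/-- A radial cut-off function, extended continuously to `[-∞, ∞]^ι`. -/
def radialTest {ι : Type*} {d : ℕ} (N : Seminorm ℝ (Fin d → ℝ)) (e : Fin d → ι) (R a b : ℝ) :
    C(ι → EReal, ℝ) where
  toFun y := ramp a b (N (clampVec R e y))
  continuous_toFun := (ramp_continuous a b).comp
    ((seminorm_continuous N).comp (clampVec_continuous R e))

theorem radialTest_apply {ι : Type*} {d : ℕ} (N : Seminorm ℝ (Fin d → ℝ)) (e : Fin d → ι)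
    (R a b : ℝ) (y : ι → EReal) : radialTest N e R a b y = ramp a b (N (clampVec R e y)) := rfl

/-- Truncation at `b / c` is invisible on finite points: if it alters a coordinate, both the
original and the truncated vector have `N` at least `b`, where the ramp is already `1`. -/
theorem radialTest_coe {ι : Type*} {d : ℕ} {N : Seminorm ℝ (Fin d → ℝ)} {c : ℝ} (hc : 0 < c)
    (hcN : ∀ x, c * ‖x‖ ≤ N x) (e : Fin d → ι) {a b : ℝ} (hab : a < b) (hb : 0 < b)
    (z : ι → ℝ) :
    radialTest N e (b / c) a b (fun j => (z j : EReal)) = ramp a b (N (fun l => z (e l))) := by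
  have hR : 0 ≤ b / c := by positivity
  rw [radialTest_apply]
  by_cases h : ∀ l, |z (e l)| ≤ b / c
  · congr 2
    funext l
    obtain ⟨h1, h2⟩ := abs_le.1 (h l)
    rw [clampVec, clamp_coe, min_eq_right h2, max_eq_right h1]
  · push Not at h
    obtain ⟨l, hl⟩ := h
    have key : ∀ x : Fin d → ℝ, b / c ≤ |x l| → ramp a b (N x) = 1 := fun x hx =>
      ramp_eq_one hab (by
        have h1 : b / c ≤ ‖x‖ := hx.trans (norm_le_pi_norm x l)
        rw [div_le_iff₀ hc] at h1
        linarith [hcN x])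
    rw [key (fun l => z (e l)) hl.le, key]
    rw [clampVec, abs_clamp_coe hR, min_eq_left hl.le]

theorem clampVec_zero {ι : Type*} {d : ℕ} {R : ℝ} (hR : 0 ≤ R) (e : Fin d → ι) :
    clampVec R e 0 = 0 := by
  funext l
  have : clamp R ((0 : ℝ) : EReal) = 0 := by
    rw [clamp_coe, min_eq_right hR, max_eq_right (by linarith)]
  exact this

theorem eventually_clampVec_lt {ι : Type*} {d : ℕ} (N : Seminorm ℝ (Fin d → ℝ))
    (e : Fin d → ι) {R a : ℝ} (hR : 0 ≤ R) (ha : 0 < a) :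
    ∀ᶠ y in 𝓝 (0 : ι → EReal), N (clampVec R e y) < a := by
  have hcont : Continuous fun y : ι → EReal => N (clampVec R e y) :=
    (seminorm_continuous N).comp (clampVec_continuous R e)
  refine (hcont.tendsto 0).eventually_lt_const ?_
  rw [clampVec_zero hR, map_zero]
  exact ha

theorem radialTest_eventually_zero {ι : Type*} {d : ℕ} (N : Seminorm ℝ (Fin d → ℝ))
    (e : Fin d → ι) {R a b : ℝ} (hR : 0 ≤ R) (ha : 0 < a) (hab : a < b) :
    ∀ᶠ y in 𝓝 (0 : ι → EReal), radialTest N e R a b y = 0 := by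
  filter_upwards [eventually_clampVec_lt N e hR ha] with y hy
  rw [radialTest_apply, ramp_eq_zero hab hy.le]

theorem IsTailMeasure.integrable_radialTest {ι : Type*} [Fintype ι] {m : Measure (ι → EReal)}
    (hm : IsTailMeasure m) {d : ℕ} (N : Seminorm ℝ (Fin d → ℝ)) (e : Fin d → ι) {R a b : ℝ}
    (hR : 0 ≤ R) (ha : 0 < a) (hab : a < b) : Integrable (radialTest N e R a b) m := by
  obtain ⟨U, hU, hUo, h0⟩ := eventually_nhds_iff.1 (radialTest_eventually_zero N e hR ha hab)
  have hfin := hm.finite_away U hUo h0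
  have hon : IntegrableOn (radialTest N e R a b) Uᶜ m := by
    refine Measure.integrableOn_of_bounded (M := 1) hfin.ne
      (radialTest N e R a b).continuous.measurable.aestronglyMeasurable ?_
    refine ae_of_all _ fun y => ?_
    rw [radialTest_apply, Real.norm_of_nonneg (ramp_nonneg _ _ _)]
    exact ramp_le_one _ _ _
  refine (integrableOn_iff_integrable_of_support_subset ?_).1 hon
  intro y hy hyU
  exact hy (hU y hyU)

/-- Vanishing integrals make the positivity set of each test function null. For `s = 1 / (n + 1)`
these sets cover everything but the origin, since surjectivity of `e` lets the test functions see
every coordinate; so `m` would be zero. -/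
theorem IsTailMeasure.eq_zero_of_integral_radialTest {ι : Type*} [Fintype ι]
    {m : Measure (ι → EReal)} (hm : IsTailMeasure m) {d : ℕ} {N : Seminorm ℝ (Fin d → ℝ)} {c : ℝ}
    (hc : 0 < c) (hcN : ∀ x, c * ‖x‖ ≤ N x) {e : Fin d → ι} (he : Function.Surjective e)
    (h : ∀ s : ℝ, 0 < s → ∫ y, radialTest N e (s * 2 / c) (s * 1) (s * 2) y ∂m = 0) : False := by
  have hnull : ∀ n : ℕ, m {y | (1 / ((n : ℝ) + 1)) * 1 <
      N (clampVec ((1 / ((n : ℝ) + 1)) * 2 / c) e y)} = 0 := by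
    intro n
    set s : ℝ := 1 / ((n : ℝ) + 1)
    have hs : 0 < s := by positivity
    have h0 := (integral_eq_zero_iff_of_nonneg (fun y => ramp_nonneg _ _ _)
      (hm.integrable_radialTest N e (R := s * 2 / c) (by positivity)
        (by linarith : 0 < s * 1) (by linarith : s * 1 < s * 2))).1 (h s hs)
    refine measure_mono_null ?_ (ae_iff.1 h0)
    intro y hy
    exact (ramp_pos (by linarith) hy).ne'
  have hcover : (Set.univ : Set (ι → EReal)) ⊆ {0} ∪ ⋃ n : ℕ, {y | (1 / ((n : ℝ) + 1)) * 1 <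
      N (clampVec ((1 / ((n : ℝ) + 1)) * 2 / c) e y)} := by
    intro y _
    by_cases hy : y = 0
    · exact Or.inl hy
    · right
      obtain ⟨j, hj⟩ := Function.ne_iff.1 hy
      obtain ⟨l, rfl⟩ := he j
      -- A nonzero coordinate, infinite ones included, stays bounded away from zero under
      -- truncation, up to the truncation level itself.
      have key : ∃ δ : ℝ, 0 < δ ∧ ∀ R : ℝ, 0 ≤ R → min R δ ≤ |clamp R (y (e l))| := by
        induction hye : y (e l) using EReal.rec with
        | bot => exact ⟨1, one_pos, fun R hR => by rw [abs_clamp_bot hR]; exact min_le_left _ _⟩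
        | top => exact ⟨1, one_pos, fun R hR => by rw [abs_clamp_top hR]; exact min_le_left _ _⟩
        | coe z =>
          refine ⟨|z|, abs_pos.2 ?_, fun R hR => by rw [abs_clamp_coe hR]⟩
          rintro rfl
          exact hj (by rw [hye]; rfl)
      obtain ⟨δ, hδ, hδR⟩ := key
      obtain ⟨n, hn⟩ := exists_nat_one_div_lt (show 0 < c * δ by positivity)
      refine Set.mem_iUnion.2 ⟨n, ?_⟩
      set s : ℝ := 1 / ((n : ℝ) + 1)
      have hs : 0 < s := by positivity
      have h1 := hδR (s * 2 / c) (by positivity)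
      have h2 : |clamp (s * 2 / c) (y (e l))| ≤ ‖clampVec (s * 2 / c) e y‖ :=
        norm_le_pi_norm (clampVec (s * 2 / c) e y) l
      have h3 : s * 1 < c * min (s * 2 / c) δ := by
        rw [mul_min_of_nonneg _ _ hc.le]
        refine lt_min ?_ (by linarith)
        rw [mul_div_cancel₀ _ hc.ne']; linarith
      calc s * 1 < c * min (s * 2 / c) δ := h3
        _ ≤ c * ‖clampVec (s * 2 / c) e y‖ := by gcongr; exact h1.trans h2
        _ ≤ _ := hcN _
  refine hm.ne_zero (Measure.measure_univ_eq_zero.1 (measure_mono_null hcover ?_))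
  exact measure_union_null hm.origin (measure_iUnion_null hnull)

/-! ## Radial regular variation -/

/-- The limits `I a b` stand in for the limit measure of radial shells and avoid any discussion of
its continuity sets. Their homogeneity is inherited from `V`, and positivity follows because `I 1 2
= 0` would, by scaling, kill the measure at all radii. -/
theorem exists_radial_limit {Ω : Type*} [MeasurableSpace Ω] {P : Measure Ω} {d : ℕ}
    {N : Seminorm ℝ (Fin d → ℝ)} (hN : ∀ x, N x = 0 → x = 0) {ι : Type*} [Fintype ι]
    {Z : Ω → ι → ℝ} {α : ℝ} (hZ : IsRegularlyVaryingVector P Z α) {e : Fin d → ι}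
    (he : Function.Surjective e) :
    ∃ (V : ℝ → ℝ) (I : ℝ → ℝ → ℝ), (∀ x, 0 < x → 0 < V x) ∧
      (∀ a b, 0 < a → a < b → Tendsto (fun x : ℝ =>
        (∫ ω, ramp a b (N (x⁻¹ • fun l => Z ω (e l))) ∂P) / V x) atTop (𝓝 (I a b))) ∧
      (∀ s a b, 0 < s → 0 < a → a < b → I (s * a) (s * b) = s ^ (-α) * I a b) ∧ 0 < I 1 2 := by
  obtain ⟨V, m, ⟨-, hVpos, hV⟩, hm, hlim⟩ := hZ
  obtain ⟨c, hc, hcN⟩ := exists_norm_lower_bound N hN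
  have hconv : ∀ a b, 0 < a → a < b → Tendsto (fun x : ℝ =>
      (∫ ω, ramp a b (N (x⁻¹ • fun l => Z ω (e l))) ∂P) / V x) atTop
      (𝓝 (∫ y, radialTest N e (b / c) a b y ∂m)) := by
    intro a b ha hab
    have hb : 0 < b := ha.trans hab
    refine (hlim _ (radialTest_eventually_zero N e (R := b / c) (by positivity) ha hab)).congr
      fun x => ?_
    congr 2
    funext ω
    rw [radialTest_coe hc hcN e hab hb (fun j => x⁻¹ * Z ω j)]
    rfl
  have hscale : ∀ s a b, 0 < s → 0 < a → a < b →
      ∫ y, radialTest N e (s * b / c) (s * a) (s * b) y ∂m =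
        s ^ (-α) * ∫ y, radialTest N e (b / c) a b y ∂m := by
    intro s a b hs ha hab
    -- Replacing `x` by `s * x` in the limit for `(a, b)` amounts to using the cut-off `(s * a, s *
    -- b)` at `x`, and costs the factor `V (s * x) / V x`.
    refine tendsto_nhds_unique (hconv (s * a) (s * b) (by positivity) (by gcongr)) ?_
    have hsx : Tendsto (fun x : ℝ => s * x) atTop atTop := tendsto_id.const_mul_atTop hs
    refine ((hV s hs).mul ((hconv a b ha hab).comp hsx)).congr' ?_
    filter_upwards [eventually_gt_atTop 0] with x hx
    have h1 : ∀ ω, ramp a b (N ((s * x)⁻¹ • fun l => Z ω (e l))) =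
        ramp (s * a) (s * b) (N (x⁻¹ • fun l => Z ω (e l))) := by
      intro ω
      rw [← ramp_smul hs, map_smul_eq_mul, map_smul_eq_mul, Real.norm_of_nonneg (by positivity),
        Real.norm_of_nonneg (by positivity), mul_inv, ← mul_assoc, ← mul_assoc,
        mul_inv_cancel₀ hs.ne', one_mul]
    have h2 : V (s * x) ≠ 0 := (hVpos _ (by positivity)).ne'
    simp only [Function.comp_apply, h1]
    field_simp
  refine ⟨V, fun a b => ∫ y, radialTest N e (b / c) a b y ∂m, hVpos, hconv, hscale, ?_⟩
  refine lt_of_le_of_ne (integral_nonneg fun y => ramp_nonneg _ _ _) fun h0 => ?_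
  refine hm.eq_zero_of_integral_radialTest hc hcN he fun s hs => ?_
  rw [hscale s 1 2 hs one_pos one_lt_two]
  exact mul_eq_zero_of_right _ h0.symm

/-! ## Stationarity -/

variable {Ω : Type*} [MeasurableSpace Ω] {P : Measure Ω} {k d : ℕ} {N : Seminorm ℝ (Fin d → ℝ)}
  {X : (Fin k → ℤ) → Ω → Fin d → ℝ}

theorem IsStationary.map_eq (hs : IsStationary P X) (hX : ∀ t, Measurable (X t))
    (t : Fin k → ℤ) : P.map (X t) = P.map (X 0) := by
  have h := congrArg (fun μ => μ.map fun x : (Fin k → ℤ) → Fin d → ℝ => x 0) (hs t)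
  rw [Measure.map_map (by fun_prop) (by fun_prop), Measure.map_map (by fun_prop) (by fun_prop)] at h
  have h1 : ((fun x : (Fin k → ℤ) → Fin d → ℝ => x 0) ∘ fun ω s => X (s + t) ω) = X t := by
    funext ω; simp
  rwa [h1] at h

theorem IsStationary.integral_eq (hs : IsStationary P X) (hX : ∀ t, Measurable (X t))
    (t : Fin k → ℤ) {g : (Fin d → ℝ) → ℝ} (hg : Continuous g) :
    ∫ ω, g (X t ω) ∂P = ∫ ω, g (X 0 ω) ∂P := by
  rw [← integral_map (hX t).aemeasurable hg.measurable.aestronglyMeasurable, hs.map_eq hX t,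
    integral_map (hX 0).aemeasurable hg.measurable.aestronglyMeasurable]

/-- Invariance of the law of the whole field is applied to a cylinder set; this is what later moves
the corner to the origin. -/
theorem IsStationary.measure_exceedance_eq (hs : IsStationary P X) (hX : ∀ t, Measurable (X t))
    (h : Fin k → ℤ) (S : Finset (Fin k → ℤ)) (u : ℝ) :
    P ({ω | u < N (X h ω)} ∩ {ω | ∀ t ∈ S, N (X (t + h) ω) ≤ u}) =
      P ({ω | u < N (X 0 ω)} ∩ {ω | ∀ t ∈ S, N (X t ω) ≤ u}) := by
  have hNm : Measurable N := (seminorm_continuous N).measurable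
  set B : Set ((Fin k → ℤ) → Fin d → ℝ) := {x | u < N (x 0)} ∩ ⋂ t ∈ S, {x | N (x t) ≤ u}
  have hB : MeasurableSet B :=
    (measurableSet_lt measurable_const (by fun_prop)).inter
      (S.measurableSet_biInter fun t _ => measurableSet_le (by fun_prop) measurable_const)
  have h1 := congrArg (fun μ => μ B) (hs h)
  rw [Measure.map_apply (by fun_prop) hB, Measure.map_apply (by fun_prop) hB] at h1
  convert h1 using 2 <;> ext ω <;> simp [B]

theorem measurableSet_exceedance (hX : ∀ t, Measurable (X t)) (t : Fin k → ℤ) (u : ℝ) :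
    MeasurableSet {ω | u < N (X t ω)} :=
  measurableSet_lt measurable_const ((seminorm_continuous N).measurable.comp (hX t))

theorem IsStationary.measure_exceedance (hs : IsStationary P X) (hX : ∀ t, Measurable (X t))
    (h : Fin k → ℤ) (u : ℝ) : P {ω | u < N (X h ω)} = P {ω | u < N (X 0 ω)} := by
  simpa using hs.measure_exceedance_eq (N := N) hX h ∅ u

theorem IsStationary.cond_exceedance_eq (hs : IsStationary P X) (hX : ∀ t, Measurable (X t))
    (h : Fin k → ℤ) (S : Finset (Fin k → ℤ)) (u : ℝ) :
    cond P {ω | u < N (X h ω)} {ω | ∀ t ∈ S, N (X (t + h) ω) ≤ u} =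
      cond P {ω | u < N (X 0 ω)} {ω | ∀ t ∈ S, N (X t ω) ≤ u} := by
  rw [cond_apply (measurableSet_exceedance hX h u), cond_apply (measurableSet_exceedance hX 0 u),
    hs.measure_exceedance_eq hX, hs.measure_exceedance hX]

/-! ## The tail field -/

variable {Ω' : Type*} [MeasurableSpace Ω'] {P' : Measure Ω'} {Y : (Fin k → ℤ) → Ω' → Fin d → ℝ}

/-- Conditioning on a null event gives the zero measure, against which the constant `1` integrates
to `0`, while the tail field limit is `1`. -/
theorem IsTailField.measure_exceedance_ne_zero [IsProbabilityMeasure P']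
    (h : IsTailField P P' N X Y) (x : ℝ) : P {ω | x < N (X 0 ω)} ≠ 0 := by
  intro h0
  have hlim := h ∅ (BoundedContinuousFunction.const _ 1)
  simp only [BoundedContinuousFunction.const_apply, integral_const, probReal_univ, one_smul] at hlim
  refine zero_ne_one (tendsto_nhds_unique (tendsto_const_nhds.congr' ?_) hlim)
  filter_upwards [eventually_ge_atTop x] with y hy
  have : P {ω | y < N (X 0 ω)} = 0 :=
    measure_mono_null (fun ω (hω : y < N (X 0 ω)) => hy.trans_lt hω) h0
  rw [cond_eq_zero_of_meas_eq_zero this]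
  simp

theorem integral_cond_le {g : Ω → ℝ} (hg : Integrable g P) (hg0 : 0 ≤ g) (E : Set Ω) :
    ∫ ω, g ω ∂(cond P E) ≤ (∫ ω, g ω ∂P) / P.real E := by
  rw [ProbabilityTheory.cond, integral_smul_measure, ENNReal.toReal_inv, smul_eq_mul, ← div_eq_inv_mul]
  exact div_le_div_of_nonneg_right (setIntegral_le_integral hg (ae_of_all _ hg0)) measureReal_nonneg

theorem integrable_ramp [IsFiniteMeasure P] {Z : Ω → Fin d → ℝ} (hZ : Measurable Z) (a b : ℝ) :
    Integrable (fun ω => ramp a b (N (Z ω))) P := by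
  refine Integrable.of_bound (C := 1) ?_ (ae_of_all _ fun ω => ?_)
  · exact ((ramp_continuous a b).comp (seminorm_continuous N)).measurable.comp hZ
      |>.aestronglyMeasurable
  · rw [Real.norm_of_nonneg (ramp_nonneg _ _ _)]; exact ramp_le_one _ _ _

theorem IsTailField.tendsto_integral_ramp_sub [IsProbabilityMeasure P] [IsProbabilityMeasure P']
    (h : IsTailField P P' N X Y) (t : Fin k → ℤ) (a b a' b' : ℝ) :
    Tendsto (fun x : ℝ => ∫ ω, (ramp a b (N (x⁻¹ • X t ω)) - ramp a' b' (N (x⁻¹ • X t ω)))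
        ∂(cond P {ω | x < N (X 0 ω)})) atTop
      (𝓝 (∫ ω, (ramp a b (N (Y t ω)) - ramp a' b' (N (Y t ω))) ∂P')) := by
  have hc : Continuous fun y : ({t} : Finset (Fin k → ℤ)) → Fin d → ℝ =>
      ramp a b (N (y ⟨t, Finset.mem_singleton_self t⟩)) -
        ramp a' b' (N (y ⟨t, Finset.mem_singleton_self t⟩)) := by
    have h1 := (seminorm_continuous N).comp
      (continuous_apply (A := fun _ : ({t} : Finset (Fin k → ℤ)) => Fin d → ℝ)
        ⟨t, Finset.mem_singleton_self t⟩)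
    exact ((ramp_continuous a b).comp h1).sub ((ramp_continuous a' b').comp h1)
  refine h {t} (BoundedContinuousFunction.ofNormedAddCommGroup _ hc 1 fun y => ?_)
  exact abs_sub_le_of_nonneg_of_le (ramp_nonneg _ _ _) (ramp_le_one _ _ _) (ramp_nonneg _ _ _)
    (ramp_le_one _ _ _)

/-- The tail field puts no mass on the unit sphere. -/
theorem IsTailField.measure_sphere_eq_zero [IsProbabilityMeasure P] [IsProbabilityMeasure P']
    (h : IsTailField P P' N X Y) (hN : ∀ x, N x = 0 → x = 0) (hX : ∀ t, Measurable (X t))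
    (hs : IsStationary P X) {α : ℝ} (hα : 0 < α)
    (hRV : IsJointlyRegularlyVarying P X α)
    (hY : ∀ t, Measurable (Y t)) (t : Fin k → ℤ) : P' {ω | N (Y t ω) = 1} = 0 := by
  -- Only the single vector `X 0` is needed: stationarity reduces shells for `X t` to shells for `X
  -- 0`.
  obtain ⟨V, I, hV, hI, hscale, hpos⟩ := exists_radial_limit hN
    (hRV 1 one_pos (fun _ => 0)) (e := fun l => ((0 : Fin 1), l))
    (fun j => ⟨j.2, Prod.ext (Subsingleton.elim _ _) rfl⟩)
  change ∀ a b, 0 < a → a < b → Tendsto (fun x : ℝ =>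
    (∫ ω, ramp a b (N (x⁻¹ • X 0 ω)) ∂P) / V x) atTop (𝓝 (I a b)) at hI
  have hint : ∀ (a b x : ℝ) (s : Fin k → ℤ),
      Integrable (fun ω => ramp a b (N (x⁻¹ • X s ω))) P := fun a b x s =>
    integrable_ramp ((hX s).const_smul x⁻¹) a b
  have hbound : ∀ a b a' b', 0 < a → a < b → b ≤ a' → a' < b' →
      ∫ ω, (ramp a b (N (Y t ω)) - ramp a' b' (N (Y t ω))) ∂P' ≤ (I a b - I a' b') / I 1 2 := by
    intro a b a' b' ha hab hba hab'
    refine le_of_tendsto_of_tendsto (h.tendsto_integral_ramp_sub t a b a' b')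
      (((hI a b ha hab).sub (hI a' b' (by linarith) hab')).div
        (hI 1 2 one_pos one_lt_two) hpos.ne') ?_
    filter_upwards [eventually_gt_atTop 0,
      (hI 1 2 one_pos one_lt_two).eventually_const_lt hpos] with x hx hx2
    have hVx := hV x hx
    have hden : 0 < ∫ ω, ramp 1 2 (N (x⁻¹ • X 0 ω)) ∂P := by
      rwa [lt_div_iff₀ hVx, zero_mul] at hx2
    -- The ramp from `1` to `2` lies below the indicator of an exceedance, so its integral bounds
    -- the conditioning probability from below on the scale of `V`.
    have hle : ∫ ω, ramp 1 2 (N (x⁻¹ • X 0 ω)) ∂P ≤ P.real {ω | x < N (X 0 ω)} := by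
      rw [← integral_indicator_one (measurableSet_exceedance hX 0 x)]
      refine integral_mono (hint _ _ _ _)
        ((integrable_const 1).indicator (measurableSet_exceedance hX 0 x)) fun ω => ?_
      by_cases hω : x < N (X 0 ω)
      · rw [Set.indicator_of_mem (show ω ∈ {ω | x < N (X 0 ω)} from hω)]
        exact ramp_le_one _ _ _
      · rw [Set.indicator_of_notMem (show ω ∉ {ω | x < N (X 0 ω)} from hω)]
        refine (ramp_eq_zero one_lt_two ?_).le
        rw [map_smul_eq_mul, Real.norm_of_nonneg (by positivity), inv_mul_le_iff₀ hx, mul_one]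
        exact not_lt.1 hω
    have hnn : ∀ s : Fin k → ℤ,
        0 ≤ fun ω => ramp a b (N (x⁻¹ • X s ω)) - ramp a' b' (N (x⁻¹ • X s ω)) :=
      fun s ω => sub_nonneg.2 (ramp_anti hab hba hab' _)
    calc _ ≤ (∫ ω, (ramp a b (N (x⁻¹ • X t ω)) - ramp a' b' (N (x⁻¹ • X t ω))) ∂P) /
          P.real {ω | x < N (X 0 ω)} :=
          integral_cond_le ((hint _ _ _ _).sub (hint _ _ _ _)) (hnn t) _
      _ = (∫ ω, (ramp a b (N (x⁻¹ • X 0 ω)) - ramp a' b' (N (x⁻¹ • X 0 ω))) ∂P) /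
          P.real {ω | x < N (X 0 ω)} := by
          have hg : Continuous fun z : Fin d → ℝ =>
              ramp a b (N (x⁻¹ • z)) - ramp a' b' (N (x⁻¹ • z)) := by
            have h1 := (seminorm_continuous N).comp (continuous_const_smul (x⁻¹) (T := Fin d → ℝ))
            exact ((ramp_continuous a b).comp h1).sub ((ramp_continuous a' b').comp h1)
          rw [hs.integral_eq hX t hg]
      _ ≤ (∫ ω, (ramp a b (N (x⁻¹ • X 0 ω)) - ramp a' b' (N (x⁻¹ • X 0 ω))) ∂P) /
          ∫ ω, ramp 1 2 (N (x⁻¹ • X 0 ω)) ∂P :=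
          div_le_div_of_nonneg_left (integral_nonneg (hnn 0)) hden hle
      _ = _ := by
          rw [integral_sub (hint _ _ _ _) (hint _ _ _ _)]
          simp only [Pi.div_apply]
          field_simp
  have hImono : ∀ a b a' b', 0 < a → a < b → b ≤ a' → a' < b' → I a' b' ≤ I a b := by
    intro a b a' b' ha hab hba hab'
    refine le_of_tendsto_of_tendsto (hI a' b' (by linarith) hab') (hI a b ha hab) ?_
    filter_upwards [eventually_gt_atTop 0] with x hx
    have hVx := hV x hx
    gcongr
    · exact hint _ _ _ _
    · exact hint _ _ _ _
    · exact fun ω => ramp_anti hab hba hab' _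
  -- For `1 < c < 2` one has `1 / 4 < c⁻²`, so this bounds `I (c ^ 2)⁻¹ c⁻¹ / I 1 2` uniformly in
  -- `c`.
  set K := I (1 / 8) (1 / 4) / I 1 2
  have hreal : ∀ c : ℝ, 1 < c → c < 2 →
      P'.real {ω | N (Y t ω) = 1} ≤ (1 - (c ^ 3) ^ (-α)) * K := by
    intro c hc1 hc2
    have hc0 : 0 < c := by linarith
    have hlt : (c ^ 2)⁻¹ < c⁻¹ := inv_strictAnti₀ hc0 (by nlinarith)
    -- The difference of the two ramps is `1` on the unit sphere, and scaling by `c ^ 3` carries the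
    -- inner ramp to the outer one. Homogeneity then leaves the factor `1 - (c ^ 3) ^ (-α)`, which
    -- tends to `0` as `c ↓ 1`.
    have hb := hbound (c ^ 2)⁻¹ c⁻¹ c (c ^ 2) (by positivity) hlt
      ((inv_le_one_of_one_le₀ hc1.le).trans hc1.le) (by nlinarith)
    have hsc := hscale (c ^ 3) (c ^ 2)⁻¹ c⁻¹ (by positivity) (by positivity) hlt
    rw [show c ^ 3 * (c ^ 2)⁻¹ = c by field_simp, show c ^ 3 * c⁻¹ = c ^ 2 by field_simp] at hsc
    have hm := hImono (1 / 8) (1 / 4) (c ^ 2)⁻¹ c⁻¹ (by norm_num) (by norm_num)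
      (by rw [one_div]; exact inv_anti₀ (by positivity) (by nlinarith)) hlt
    have hpow : (c ^ 3) ^ (-α) ≤ 1 :=
      Real.rpow_le_one_of_one_le_of_nonpos (one_le_pow₀ hc1.le) (by linarith)
    have hYint : ∀ a b, Integrable (fun ω => ramp a b (N (Y t ω))) P' := fun a b =>
      integrable_ramp (hY t) a b
    have hsph : MeasurableSet {ω | N (Y t ω) = 1} :=
      measurableSet_eq_fun ((seminorm_continuous N).measurable.comp (hY t)) measurable_const
    calc P'.real {ω | N (Y t ω) = 1}
        = ∫ ω, {ω | N (Y t ω) = 1}.indicator 1 ω ∂P' := (integral_indicator_one hsph).symm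
      _ ≤ _ := by
        refine integral_mono ((integrable_const 1).indicator hsph)
          ((hYint (c ^ 2)⁻¹ c⁻¹).sub (hYint c (c ^ 2))) fun ω => ?_
        by_cases hω : N (Y t ω) = 1
        · rw [Set.indicator_of_mem (show ω ∈ {ω | N (Y t ω) = 1} from hω)]
          simp only [Pi.one_apply, hω]
          rw [ramp_eq_one hlt (inv_le_one_of_one_le₀ hc1.le),
            ramp_eq_zero (show c < c ^ 2 by nlinarith) hc1.le, sub_zero]
        · rw [Set.indicator_of_notMem (show ω ∉ {ω | N (Y t ω) = 1} from hω)]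
          exact sub_nonneg.2 (ramp_anti hlt
            ((inv_le_one_of_one_le₀ hc1.le).trans hc1.le) (by nlinarith) _)
      _ ≤ (I (c ^ 2)⁻¹ c⁻¹ - I c (c ^ 2)) / I 1 2 := hb
      _ = (1 - (c ^ 3) ^ (-α)) * (I (c ^ 2)⁻¹ c⁻¹ / I 1 2) := by rw [hsc]; ring
      _ ≤ (1 - (c ^ 3) ^ (-α)) * K := by
        refine mul_le_mul_of_nonneg_left ?_ (by linarith)
        exact div_le_div_of_nonneg_right hm hpos.le
  have hlim : Tendsto (fun c : ℝ => (1 - (c ^ 3) ^ (-α)) * K) (𝓝[>] 1) (𝓝 0) := by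
    have hcont : ContinuousAt (fun c : ℝ => (1 - (c ^ 3) ^ (-α)) * K) 1 := by
      refine (continuousAt_const.sub (ContinuousAt.rpow_const (by fun_prop) ?_)).mul
        continuousAt_const
      simp
    have := hcont.tendsto
    simp only [one_pow, Real.one_rpow, sub_self, zero_mul] at this
    exact this.mono_left nhdsWithin_le_nhds
  have hle : P'.real {ω | N (Y t ω) = 1} ≤ 0 := by
    refine ge_of_tendsto hlim ?_
    filter_upwards [Ioo_mem_nhdsGT (one_lt_two : (1 : ℝ) < 2)] with c hc
    exact hreal c hc.1 hc.2
  exact (measureReal_eq_zero_iff).1 (le_antisymm hle measureReal_nonneg)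

theorem frontier_forall_le_subset {ι : Type*} [Finite ι] :
    frontier {y : ι → Fin d → ℝ | ∀ s, N (y s) ≤ 1} ⊆ ⋃ s, {y | N (y s) = 1} := by
  have hN := seminorm_continuous N
  have hcl : IsClosed {y : ι → Fin d → ℝ | ∀ s, N (y s) ≤ 1} := by
    simp only [Set.ofPred_forall]
    exact isClosed_iInter fun s => isClosed_le (hN.comp (continuous_apply s)) continuous_const
  have hop : IsOpen {y : ι → Fin d → ℝ | ∀ s, N (y s) < 1} := by
    simp only [Set.ofPred_forall]
    exact isOpen_iInter_of_finite fun s =>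
      isOpen_lt (hN.comp (continuous_apply s)) continuous_const
  intro y hy
  rw [hcl.frontier_eq] at hy
  by_contra hne
  simp only [Set.mem_iUnion, not_exists] at hne
  exact hy.2 (interior_maximal (fun z hz s => (hz s).le) hop
    fun s => lt_of_le_of_ne (hy.1 s) (hne s))

/-- The portmanteau theorem: the boundary of the event lies in the finite union of the spheres `N (y
s) = 1`, which are null for the tail field. -/
theorem IsTailField.tendsto_cond [IsProbabilityMeasure P] [IsProbabilityMeasure P']
    (h : IsTailField P P' N X Y) (hX : ∀ t, Measurable (X t)) (hY : ∀ t, Measurable (Y t))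
    (hnull : ∀ t, P' {ω | N (Y t ω) = 1} = 0) (S : Finset (Fin k → ℤ)) :
    Tendsto (fun x : ℝ => cond P {ω | x < N (X 0 ω)} {ω | ∀ t ∈ S, N (X t ω) ≤ x}) atTop
      (𝓝 (P' {ω | ∀ t ∈ S, N (Y t ω) ≤ 1})) := by
  have hNm := (seminorm_continuous N).measurable
  have hprob : ∀ x : ℝ, IsProbabilityMeasure (cond P {ω | x < N (X 0 ω)}) := fun x =>
    cond_isProbabilityMeasure (h.measure_exceedance_ne_zero x)
  have hXm : ∀ x : ℝ, Measurable fun ω (t : S) => x⁻¹ • X t ω := fun x =>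
    measurable_pi_lambda _ fun t => (hX t).const_smul x⁻¹
  have hYm : Measurable fun ω (t : S) => Y t ω := measurable_pi_lambda _ fun t => hY t
  let ν : ℝ → ProbabilityMeasure (S → Fin d → ℝ) := fun x =>
    ⟨(cond P {ω | x < N (X 0 ω)}).map fun ω t => x⁻¹ • X t ω,
      Measure.isProbabilityMeasure_map (hXm x).aemeasurable⟩
  let ν' : ProbabilityMeasure (S → Fin d → ℝ) :=
    ⟨P'.map fun ω t => Y t ω, Measure.isProbabilityMeasure_map hYm.aemeasurable⟩
  have hconv : Tendsto ν atTop (𝓝 ν') := by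
    rw [ProbabilityMeasure.tendsto_iff_forall_integral_tendsto]
    intro f
    have hf := f.continuous.measurable
    simp only [ν, ν', ProbabilityMeasure.coe_mk]
    rw [integral_map hYm.aemeasurable hf.aestronglyMeasurable]
    refine (h S f).congr fun x => ?_
    rw [integral_map (hXm x).aemeasurable hf.aestronglyMeasurable]
  have hG : MeasurableSet {y : S → Fin d → ℝ | ∀ s, N (y s) ≤ 1} := by
    simp only [Set.ofPred_forall]
    exact MeasurableSet.iInter fun s =>
      measurableSet_le (hNm.comp (measurable_pi_apply s)) measurable_const
  have hfr : (ν' : Measure (S → Fin d → ℝ))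
      (frontier {y : S → Fin d → ℝ | ∀ s, N (y s) ≤ 1}) = 0 := by
    refine measure_mono_null frontier_forall_le_subset (measure_iUnion_null fun s => ?_)
    change (P'.map fun ω (t : S) => Y t ω) _ = 0
    have hsphere : MeasurableSet {y : S → Fin d → ℝ | N (y s) = 1} :=
      measurableSet_eq_fun (hNm.comp (measurable_pi_apply s)) measurable_const
    rw [Measure.map_apply hYm hsphere]
    exact hnull s
  have hmain := ProbabilityMeasure.tendsto_measure_of_null_frontier_of_tendsto' hconv hfr
  have hlimit : (ν' : Measure (S → Fin d → ℝ)) {y | ∀ s, N (y s) ≤ 1} =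
      P' {ω | ∀ t ∈ S, N (Y t ω) ≤ 1} := by
    change (P'.map fun ω (t : S) => Y t ω) _ = _
    rw [Measure.map_apply hYm hG]
    congr 1
    ext ω
    simp
  rw [hlimit] at hmain
  refine hmain.congr' ?_
  filter_upwards [eventually_gt_atTop 0] with x hx
  change ((cond P {ω | x < N (X 0 ω)}).map fun ω (t : S) => x⁻¹ • X t ω) _ = _
  rw [Measure.map_apply (hXm x) hG]
  congr 1
  ext ω
  simp [map_smul_eq_mul, abs_of_pos hx, inv_mul_le_iff₀ hx]

/-! ## Boxes at the corners of blocks -/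

/-- Nonnegativity of `u` is needed because the maximum over the empty set is `0`. -/
theorem maxNorm_le_iff {Ω : Type*} {k d : ℕ} {N : Seminorm ℝ (Fin d → ℝ)}
    {X : (Fin k → ℤ) → Ω → Fin d → ℝ} {A : Finset (Fin k → ℤ)} {ω : Ω} {u : ℝ} (hu : 0 ≤ u) :
    maxNorm N X A ω ≤ u ↔ ∀ t ∈ A, N (X t ω) ≤ u := by
  rw [maxNorm, ← Real.le_toNNReal_iff_coe_le hu, Finset.sup_le_iff]
  simp only [Real.toNNReal_le_toNNReal_iff hu]

/-- The points of the orthant determined by `i`, of coordinates at most `M` in absolute value. -/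
def orthantBox {k : ℕ} (i : Fin k → Fin 2) (M : ℕ) : Finset (Fin k → ℤ) :=
  Finset.Icc (fun l => if i l = 1 then -(M : ℤ) else 0) (fun l => if i l = 1 then 0 else (M : ℤ))

theorem mem_orthantBox {k : ℕ} {i : Fin k → Fin 2} {M : ℕ} {t : Fin k → ℤ} :
    t ∈ orthantBox i M ↔ ∀ l, 0 ≤ t l * (1 - 2 * ((i l : ℕ) : ℤ)) ∧ |t l| ≤ M := by
  rw [orthantBox, Finset.mem_Icc, Pi.le_def, Pi.le_def, ← forall_and]
  refine forall_congr' fun l => ?_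
  rw [abs_le]
  rcases Fin.exists_fin_two.1 ⟨i l, rfl⟩ with h | h <;> simp [h] <;> omega

/-- Sides of at least `M + 1` points keep the opposite faces of the block from cutting the box. -/
theorem mem_cornerBox_iff {k : ℕ} {r : Fin k → ℕ} {i : Fin k → Fin 2} {M : ℕ}
    (hr : ∀ l, M + 1 ≤ r l) (t : Fin k → ℤ) :
    t + corner r i ∈ cornerBox r i M ↔ t ∈ orthantBox i M := by
  rw [cornerBox, Finset.mem_filter, block, Finset.mem_Icc, orthantBox, Finset.mem_Icc]
  simp only [Pi.le_def, ← forall_and]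
  refine forall_congr' fun l => ?_
  have hl := hr l
  simp only [corner, Pi.add_apply, Pi.zero_apply, abs_le]
  split_ifs <;> omega

theorem cornerBox_subset_block {k : ℕ} (r : Fin k → ℕ) (i : Fin k → Fin 2) (M : ℕ) :
    cornerBox r i M ⊆ block r := Finset.filter_subset _ _

theorem cornerBox_eq_block {k : ℕ} {r : Fin k → ℕ} (i : Fin k → Fin 2) {M : ℕ}
    (hr : ∀ l, r l ≤ M + 1) : cornerBox r i M = block r := by
  refine Finset.filter_true_of_mem fun t ht l => ?_
  rw [block, Finset.mem_Icc] at ht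
  have h1 := ht.1 l
  have h2 := ht.2 l
  have hl := hr l
  simp only [corner, abs_le, Pi.zero_apply] at *
  split_ifs <;> omega

theorem IsStationary.cond_cornerBox (hs : IsStationary P X) (hX : ∀ t, Measurable (X t))
    {r : Fin k → ℕ} {i : Fin k → Fin 2} {M : ℕ} (hr : ∀ l, M + 1 ≤ r l) {u : ℝ} (hu : 0 ≤ u) :
    cond P {ω | u < N (X (corner r i) ω)}
        {ω | maxNorm N X (cornerBox r i M \ {corner r i}) ω ≤ u} =
      cond P {ω | u < N (X 0 ω)} {ω | ∀ t ∈ orthantBox i M \ {0}, N (X t ω) ≤ u} := by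
  rw [← hs.cond_exceedance_eq hX (corner r i)]
  congr 1
  ext ω
  simp only [Set.mem_ofPred_eq, maxNorm_le_iff hu, Finset.mem_sdiff, Finset.mem_singleton]
  constructor
  · intro h t ht
    exact h _ ⟨(mem_cornerBox_iff hr t).2 ht.1, by simpa using ht.2⟩
  · intro h t ht
    have := h (t - corner r i) ⟨(mem_cornerBox_iff hr _).1 (by simpa using ht.1),
      by simpa [sub_eq_zero] using ht.2⟩
    simpa using this

theorem tendsto_orthantBox [IsProbabilityMeasure P'] (hY : ∀ t, Measurable (Y t))
    (i : Fin k → Fin 2) :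
    Tendsto (fun M : ℕ => P'.real {ω | ∀ t ∈ orthantBox i M \ {0}, N (Y t ω) ≤ 1}) atTop
      (𝓝 (tailFieldExtremalIndex P' N Y i)) := by
  have hNm := (seminorm_continuous N).measurable
  have hset : {ω | (⨆ (t : Fin k → ℤ) (_ : (∀ l, 0 ≤ t l * (1 - 2 * ((i l : ℕ) : ℤ))) ∧ t ≠ 0),
      ENNReal.ofReal (N (Y t ω))) ≤ 1} =
      ⋂ M : ℕ, {ω | ∀ t ∈ orthantBox i M \ {0}, N (Y t ω) ≤ 1} := by
    ext ω
    simp only [Set.mem_ofPred_eq, iSup_le_iff, ENNReal.ofReal_le_one, Set.mem_iInter,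
      Finset.mem_sdiff, Finset.mem_singleton]
    constructor
    · exact fun h M t ht => h t ⟨fun l => (mem_orthantBox.1 ht.1 l).1, ht.2⟩
    · intro h t ht
      -- The sum of the absolute coordinates is a convenient radius of a box containing `t`.
      refine h (∑ l, (t l).natAbs) t ⟨mem_orthantBox.2 fun l => ⟨ht.1 l, ?_⟩, ht.2⟩
      rw [Int.abs_eq_natAbs]
      exact_mod_cast Finset.single_le_sum (f := fun l => (t l).natAbs) (fun _ _ => Nat.zero_le _)
        (Finset.mem_univ l)
  rw [tailFieldExtremalIndex, hset]
  refine (ENNReal.tendsto_toReal (measure_ne_top _ _)).comp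
    (tendsto_measure_iInter_atTop (fun M => ?_) ?_ ⟨0, measure_ne_top _ _⟩)
  · simp only [Set.ofPred_forall]
    exact (Finset.measurableSet_biInter _ fun t _ =>
      measurableSet_le (hNm.comp (hY t)) measurable_const).nullMeasurableSet
  · intro M M' hMM ω hω t ht
    rw [Finset.mem_sdiff] at ht
    refine hω t (Finset.mem_sdiff.2 ⟨mem_orthantBox.2 fun l => ?_, ht.2⟩)
    have := mem_orthantBox.1 ht.1 l
    exact ⟨this.1, this.2.trans (by exact_mod_cast hMM)⟩

/-! ## Level arrays -/

/-- The smallest coordinate. -/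
def minCoord {k : ℕ} (hk : 0 < k) (n : Fin k → ℕ) : ℕ :=
  Finset.univ.inf' ⟨⟨0, hk⟩, Finset.mem_univ _⟩ n

theorem minCoord_le {k : ℕ} (hk : 0 < k) (n : Fin k → ℕ) (l : Fin k) : minCoord hk n ≤ n l :=
  Finset.inf'_le _ (Finset.mem_univ l)

theorem minCoord_mono {k : ℕ} (hk : 0 < k) : Monotone (minCoord hk) := fun _ _ h =>
  Finset.le_inf' _ _ fun l _ => (minCoord_le hk _ l).trans (h l)

theorem tendsto_minCoord {k : ℕ} (hk : 0 < k) : Tendsto (minCoord hk) atTop atTop :=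
  tendsto_atTop.2 fun b => by
    filter_upwards [eventually_ge_atTop (fun _ : Fin k => b)] with n hn
    exact Finset.le_inf' _ _ fun l _ => hn l

theorem minCoord_le_prod {k : ℕ} (hk : 0 < k) (n : Fin k → ℕ) : minCoord hk n ≤ ∏ l, n l := by
  rcases Nat.eq_zero_or_pos (minCoord hk n) with h | h
  · omega
  · exact (minCoord_le hk n ⟨0, hk⟩).trans (Nat.le_of_dvd
      (Finset.prod_pos fun l _ => h.trans_le (minCoord_le hk n l))
      (Finset.dvd_prod_of_mem n (Finset.mem_univ _)))

/-- If `u n ≤ x n`, then `u n` is exceeded at least as often as `x n`, which is incompatible with a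
finite limit `τ` for one and divergence for the other. -/
theorem IsLevelArray.eventually_lt [IsFiniteMeasure P] {τ : ℝ} {u : (Fin k → ℕ) → ℝ}
    (hu : IsLevelArray P N X τ u) {x : (Fin k → ℕ) → ℝ}
    (hx : Tendsto (fun n => (∏ l, (n l : ℝ)) * P.real {ω | x n < N (X 0 ω)}) atTop atTop) :
    ∀ᶠ n in atTop, x n < u n := by
  filter_upwards [Tendsto.eventually_lt_const (lt_add_one τ) hu,
    hx.eventually_ge_atTop (τ + 1)] with n h1 h2
  by_contra hle
  have hmono : P.real {ω | x n < N (X 0 ω)} ≤ P.real {ω | u n < N (X 0 ω)} :=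
    measureReal_mono fun ω hω => (not_lt.1 hle).trans_lt hω
  have := mul_le_mul_of_nonneg_left hmono
    (Finset.prod_nonneg fun l _ => Nat.cast_nonneg (n l) : 0 ≤ ∏ l, (n l : ℝ))
  linarith

theorem tendsto_prod_atTop (hk : 0 < k) :
    Tendsto (fun n : Fin k → ℕ => ∏ l, (n l : ℝ)) atTop atTop := by
  refine tendsto_atTop_mono (fun n => ?_) (tendsto_natCast_atTop_atTop.comp (tendsto_minCoord hk))
  have h : ((minCoord hk n : ℕ) : ℝ) ≤ ((∏ l, n l : ℕ) : ℝ) :=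
    Nat.cast_le.2 (minCoord_le_prod hk n)
  rwa [Nat.cast_prod] at h

theorem IsLevelArray.tendsto_atTop [IsFiniteMeasure P] (hk : 0 < k) {τ : ℝ} {u : (Fin k → ℕ) → ℝ}
    (hu : IsLevelArray P N X τ u) (hF : ∀ x : ℝ, P {ω | x < N (X 0 ω)} ≠ 0) :
    Tendsto u atTop atTop := by
  refine Filter.tendsto_atTop.2 fun x => ?_
  refine (hu.eventually_lt (x := fun _ => x) ?_).mono fun n hn => hn.le
  exact (tendsto_prod_atTop hk).atTop_mul_const
    (ENNReal.toReal_pos (hF x) (measure_ne_top _ _))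

/-! ## Run limits -/

theorem AntiClustering.runLimit [IsProbabilityMeasure P] [IsProbabilityMeasure P']
    (hs : IsStationary P X) (hX : ∀ t, Measurable (X t)) (hY : ∀ t, Measurable (Y t))
    (hF : ∀ x : ℝ, P {ω | x < N (X 0 ω)} ≠ 0)
    (hconv : ∀ S : Finset (Fin k → ℤ), Tendsto (fun x : ℝ =>
      cond P {ω | x < N (X 0 ω)} {ω | ∀ t ∈ S, N (X t ω) ≤ x}) atTop
      (𝓝 (P' {ω | ∀ t ∈ S, N (Y t ω) ≤ 1})))
    {i : Fin k → Fin 2} {r : (Fin k → ℕ) → (Fin k → ℕ)} (hr : Tendsto r atTop atTop)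
    {u : (Fin k → ℕ) → ℝ} (hu : Tendsto u atTop atTop) (hac : AntiClustering P N X i r u) :
    RunLimit P N X i r u (tailFieldExtremalIndex P' N Y i) := by
  refine Metric.tendsto_nhds.2 fun ε hε => ?_
  have hθ := tendsto_orthantBox (N := N) (P' := P') hY i
  -- One `M` serves two purposes: the tail field probability of the box is within `ε / 3` of its
  -- limit, and the anti-clustering limsup is below `ε / 3`. The third `ε / 3` is spent on
  -- convergence for this fixed box.
  obtain ⟨M, hM1, hM2⟩ := ((Metric.tendsto_nhds.1 hθ (ε / 3) (by positivity)).and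
    (Tendsto.eventually_lt_const (ENNReal.ofReal_pos.2 (show 0 < ε / 3 by positivity)) hac)).exists
  have hbox := ((ENNReal.tendsto_toReal (measure_ne_top _ _)).comp
    (hconv (orthantBox i M \ {0}))).comp hu
  filter_upwards [Metric.tendsto_nhds.1 hbox (ε / 3) (by positivity), eventually_lt_of_limsup_lt hM2,
    hu.eventually_ge_atTop 0, hr.eventually_ge_atTop fun _ => M + 1] with n h1 h2 hun hrn
  have : IsProbabilityMeasure (cond P {ω | u n < N (X (corner (r n) i) ω)}) :=
    cond_isProbabilityMeasure (by rw [hs.measure_exceedance hX]; exact hF _)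
  set μ := cond P {ω | u n < N (X (corner (r n) i) ω)}
  set A := {ω | maxNorm N X (block (r n) \ {corner (r n) i}) ω ≤ u n}
  set C := {ω | maxNorm N X (cornerBox (r n) i M \ {corner (r n) i}) ω ≤ u n ∧
          u n < maxNorm N X (block (r n) \ cornerBox (r n) i M) ω}
  -- The comparison is `A ⊆ B ⊆ A ∪ C`, where only the probability of `B` has a limit known
  -- beforehand.
  set B := {ω | maxNorm N X (cornerBox (r n) i M \ {corner (r n) i}) ω ≤ u n} with hB
  have hAB : A ⊆ B := fun ω hω => (maxNorm_le_iff hun).2 fun t ht =>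
    (maxNorm_le_iff hun).1 hω t
      (Finset.sdiff_subset_sdiff (cornerBox_subset_block _ _ _) subset_rfl ht)
  have hBAC : B ⊆ A ∪ C := by
    intro ω hω
    by_cases hc : u n < maxNorm N X (block (r n) \ cornerBox (r n) i M) ω
    · exact Or.inr ⟨hω, hc⟩
    · refine Or.inl ((maxNorm_le_iff hun).2 fun t ht => ?_)
      rw [Finset.mem_sdiff] at ht
      by_cases htb : t ∈ cornerBox (r n) i M
      · exact (maxNorm_le_iff hun).1 hω t (Finset.mem_sdiff.2 ⟨htb, ht.2⟩)
      · exact (maxNorm_le_iff hun).1 (not_lt.1 hc) t (Finset.mem_sdiff.2 ⟨ht.1, htb⟩)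
  have hle1 : μ.real A ≤ μ.real B := measureReal_mono hAB
  have hle2 : μ.real B ≤ μ.real A + μ.real C :=
    (measureReal_mono hBAC).trans (measureReal_union_le _ _)
  have hC : μ.real C < ε / 3 := (ENNReal.toReal_lt_of_lt_ofReal h2)
  have hBq : μ.real B = ((cond P {ω | u n < N (X 0 ω)})
      {ω | ∀ t ∈ orthantBox i M \ {0}, N (X t ω) ≤ u n}).toReal :=
    congrArg ENNReal.toReal (hs.cond_cornerBox hX hrn hun)
  simp only [Function.comp_apply] at h1
  rw [← hBq, Real.dist_eq, abs_lt] at h1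
  rw [Real.dist_eq, abs_lt] at hM1
  rw [Real.dist_eq, abs_lt]
  simp only [measureReal_def] at *
  constructor <;> linarith [h1.1, h1.2, hM1.1, hM1.2]

/-- A generalized inverse of `b`; the condition `b 0 = 0` ensures that `0` is always an admissible
value. -/
theorem exists_slow_monotone {b : ℕ → ℕ} (hb : b 0 = 0) :
    ∃ m : ℕ → ℕ, Monotone m ∧ Tendsto m atTop atTop ∧ ∀ p, b (m p) ≤ p := by
  refine ⟨fun p => Nat.findGreatest (fun m => b m ≤ p) p, fun p q hpq => ?_, ?_, fun p => ?_⟩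
  · exact Nat.findGreatest_mono (fun m hm => le_trans hm hpq) hpq
  · refine tendsto_atTop.2 fun M => ?_
    filter_upwards [eventually_ge_atTop (max M (b M))] with p hp
    exact Nat.le_findGreatest ((le_max_left _ _).trans hp) ((le_max_right _ _).trans hp)
  · exact Nat.findGreatest_spec (P := fun m => b m ≤ p) (Nat.zero_le p) (by simp [hb])

theorem hasRunExtremalIndex_of_tendsto_cond [IsProbabilityMeasure P] [IsProbabilityMeasure P']
    (hk : 0 < k) (hs : IsStationary P X) (hX : ∀ t, Measurable (X t)) (hY : ∀ t, Measurable (Y t))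
    (hF : ∀ x : ℝ, P {ω | x < N (X 0 ω)} ≠ 0)
    (hconv : ∀ S : Finset (Fin k → ℤ), Tendsto (fun x : ℝ =>
      cond P {ω | x < N (X 0 ω)} {ω | ∀ t ∈ S, N (X t ω) ≤ x}) atTop
      (𝓝 (P' {ω | ∀ t ∈ S, N (Y t ω) ≤ 1}))) (i : Fin k → Fin 2) :
    HasRunExtremalIndex P N X i (tailFieldExtremalIndex P' N Y i) := by
  have hthr : ∀ m : ℕ, ∃ x : ℝ, ∀ y, x ≤ y →
      dist (cond P {ω | y < N (X 0 ω)} {ω | ∀ t ∈ orthantBox i m \ {0}, N (X t ω) ≤ y}).toReal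
        (P'.real {ω | ∀ t ∈ orthantBox i m \ {0}, N (Y t ω) ≤ 1}) < 1 / ((m : ℝ) + 1) := by
    intro m
    exact eventually_atTop.1 (Metric.tendsto_nhds.1
      ((ENNReal.tendsto_toReal (measure_ne_top _ _)).comp (hconv (orthantBox i m \ {0}))) _
      (by positivity))
  choose x hx using hthr
  have hFpos : ∀ y : ℝ, 0 < P.real {ω | y < N (X 0 ω)} := fun y =>
    ENNReal.toReal_pos (hF y) (measure_ne_top _ _)
  -- The bound `m ^ 2` on the smallest coordinate forces the sides to be `o(n)`. The second bound
  -- makes the expected number of exceedances of `x m` at least `m`, so every level array eventually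
  -- lies above `x m`.
  obtain ⟨m, hmono, hmtop, hm⟩ := exists_slow_monotone
    (b := fun m => max (m ^ 2) ⌈(m : ℝ) / P.real {ω | x m < N (X 0 ω)}⌉₊) (by simp)
  have hmp : Tendsto (fun n => m (minCoord hk n)) atTop atTop := hmtop.comp (tendsto_minCoord hk)
  -- With side `m + 1` the block coincides with its own corner box of radius `m`, so no remainder
  -- has to be controlled.
  refine ⟨fun n _ => m (minCoord hk n) + 1, ⟨fun n n' h l => ?_, ?_, fun l => ?_⟩, ?_⟩
  · exact Nat.add_le_add_right (hmono (minCoord_mono hk h)) 1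
  · refine tendsto_atTop.2 fun b => ?_
    filter_upwards [hmp.eventually_ge_atTop (∑ l, b l)] with n hn l
    exact ((Finset.single_le_sum (fun _ _ => Nat.zero_le _) (Finset.mem_univ l)).trans hn).trans
      (Nat.le_succ _)
  · have hlim : Tendsto (fun n => (2 : ℝ) / (m (minCoord hk n) : ℝ)) atTop (𝓝 0) :=
      tendsto_const_nhds.div_atTop (tendsto_natCast_atTop_atTop.comp hmp)
    refine squeeze_zero' (Eventually.of_forall fun n => by positivity) ?_ hlim
    filter_upwards [hmp.eventually_ge_atTop 1] with n hn
    have h1 : m (minCoord hk n) ^ 2 ≤ n l :=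
      ((le_max_left _ _).trans (hm _)).trans (minCoord_le hk n l)
    have h2 : ((m (minCoord hk n) : ℝ)) ^ 2 ≤ n l := by exact_mod_cast h1
    have h3 : (1 : ℝ) ≤ m (minCoord hk n) := by exact_mod_cast hn
    rw [div_le_div_iff₀ (by nlinarith) (by linarith)]
    push_cast
    nlinarith
  · intro τ _ u hu
    have hutop := hu.tendsto_atTop hk hF
    have hxu : ∀ᶠ n in atTop, x (m (minCoord hk n)) < u n := by
      refine hu.eventually_lt ?_
      refine tendsto_atTop_mono (fun n => ?_) (tendsto_natCast_atTop_atTop.comp hmp)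
      have h1 : (m (minCoord hk n) : ℝ) /
          P.real {ω | x (m (minCoord hk n)) < N (X 0 ω)} ≤ minCoord hk n :=
        (Nat.le_ceil _).trans (by exact_mod_cast (le_max_right _ _).trans (hm _))
      rw [div_le_iff₀ (hFpos _)] at h1
      refine h1.trans (mul_le_mul_of_nonneg_right ?_ measureReal_nonneg)
      exact_mod_cast minCoord_le_prod hk n
    have hθ := (tendsto_orthantBox (N := N) (P' := P') hY i).comp hmp
    refine hθ.congr_dist ?_
    have hlim : Tendsto (fun n => 1 / ((m (minCoord hk n) : ℝ) + 1)) atTop (𝓝 0) :=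
      (tendsto_one_div_add_atTop_nhds_zero_nat (𝕜 := ℝ)).comp hmp
    refine squeeze_zero' (Eventually.of_forall fun n => dist_nonneg) ?_ hlim
    filter_upwards [hxu, hutop.eventually_ge_atTop 0] with n hn hun
    have hq := hs.cond_cornerBox (N := N) hX (r := fun _ => m (minCoord hk n) + 1) (i := i)
      (M := m (minCoord hk n)) (fun _ => le_rfl) hun
    rw [cornerBox_eq_block i fun _ => le_rfl] at hq
    rw [dist_comm, measureReal_def, hq]
    exact (hx _ _ hn.le).le

end RandomField

end

theorem mainTheorem6 {Ω Ω' : Type*} [MeasurableSpace Ω] [MeasurableSpace Ω']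
    (P : Measure Ω) [IsProbabilityMeasure P] (P' : Measure Ω') [IsProbabilityMeasure P']
    {k d : ℕ} (hk : 0 < k)
    (N : Seminorm ℝ (Fin d → ℝ)) (hN : ∀ x, N x = 0 → x = 0)
    (X : (Fin k → ℤ) → Ω → Fin d → ℝ) (hX : ∀ t, Measurable (X t))
    (hstat : RandomField.IsStationary P X)
    (α : ℝ) (hα : 0 < α) (hRV : RandomField.IsJointlyRegularlyVarying P X α)
    (Y : (Fin k → ℤ) → Ω' → Fin d → ℝ) (hY : ∀ t, Measurable (Y t))
    (htail : RandomField.IsTailField P P' N X Y)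
    (i : Fin k → Fin 2) :
    ((∀ τ : ℝ, 0 < τ → ∀ u : (Fin k → ℕ) → ℝ, RandomField.IsLevelArray P N X τ u →
        ∃ r : (Fin k → ℕ) → (Fin k → ℕ),
          RandomField.IsBlockArray r ∧ RandomField.AntiClustering P N X i r u) →
      RandomField.HasRunExtremalIndex P N X i
        (RandomField.tailFieldExtremalIndex P' N Y i)) ∧
    (∀ r : (Fin k → ℕ) → (Fin k → ℕ), RandomField.IsBlockArray r →
      ∀ τ : ℝ, 0 < τ → ∀ u : (Fin k → ℕ) → ℝ, RandomField.IsLevelArray P N X τ u →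
        RandomField.AntiClustering P N X i r u →
        RandomField.RunLimit P N X i r u
          (RandomField.tailFieldExtremalIndex P' N Y i)) := by
  have hF := htail.measure_exceedance_ne_zero
  have hconv := htail.tendsto_cond hX hY
    (htail.measure_sphere_eq_zero hN hX hstat hα hRV hY)
  refine ⟨fun _ => RandomField.hasRunExtremalIndex_of_tendsto_cond hk hstat hX hY hF hconv i, ?_⟩
  intro r hr τ _ u hu hac
  exact hac.runLimit hstat hX hY hF hconv hr.tendsto (hu.tendsto_atTop hk hF)
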